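/- Let $M>0$, $\delta>0$, and let $f\in C^2(\mathbb R)$ satisfy $f''\ge\delta$ on $[-M,M]$; let $L_f$ be a Lipschitz constant of $f$ on $[-M,M]$. The Godunov flux of $f$ is $$g^f(p,q)=\begin{cases}\min_{x\in[p,q]}f(x)&\text{if }p\le q,\\ \max_{x\in[q,p]}f(x)&\text{if }p\ge q.\end{cases}$$ Let $\Delta_k=(\Delta t_k,\Delta x_k)$, $k\in\mathbb N$, be a sequence of pairs of positive numbers such that, for every $k$, $$\frac{\Delta x_k}{\Delta t_k}\ge 2L_f\qquad\text{and}\qquad \frac{\Delta t_k}{\Delta x_k}\,\frac{\delta}{2}\,M\le 1 .$$ For every $k$ let $(q^{n}_{j+1/2})_{n,j\ge0}$ (depending on $k$) be real numbers with $|q^n_{j+1/2}|\le M$ for all $n,j\ge 0$ which satisfy the Godunov scheme $$q^{n+1}_{j+\frac12}=q^n_{j+\frac12}-\frac{\Delta t_k}{\Delta x_k}\Big(g^f(q^n_{j+\frac12},q^n_{j+\frac32})-g^f(q^n_{j-\frac12},q^n_{j+\frac12})\Big)\qquad\text{for all } n\ge0,\ j\ge1,$$ the boundary values $q^n_{1/2}$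 and the initial values $q^0_{j+1/2}$ being otherwise arbitrary. Set $$q_{\Delta_k}(t,x)=\sum_{n\ge0}\sum_{j\ge1}q^n_{j+\frac12}\,\mathbf 1_{[n\Delta t_k,(n+1)\Delta t_k)\times[j\Delta x_k,(j+1)\Delta x_k)}(t,x).$$ Then there exist a function $\rho\in L^\infty((0,+\infty)\times(0,+\infty))$ and a subsequence of $(q_{\Delta_k})_k$ that converges to $\rho$ almost everywhere on $(0,+\infty)\times(0,+\infty)$. -/

import Mathlib

open MeasureTheory Filter Topology Set
open scoped NNReal ENNReal

noncomputable section

/-- The Godunov flux of `f`: the minimum of `f` over `[p, q]` if `p ≤ q`, and the maximum of `f`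
over `[q, p]` if `q ≤ p` (for continuous `f` the extrema are attained; for `p = q` both
expressions are `f p`). -/
def godunovFlux (f : ℝ → ℝ) (p q : ℝ) : ℝ :=
  if p ≤ q then sInf (f '' Icc p q) else sSup (f '' Icc q p)

/-- `q n j` stands for `q^n_{j+1/2}`, with `n, j ≥ 0`. The array solves the explicit Godunov scheme
with time step `Δt` and space step `Δx` in all the cells with index `≥ 1`; the equation below is
the one of the cell with index `j + 1`. The boundary values `q n 0` and the initial values `q 0 j`
are free. -/
def IsGodunovSolution (f : ℝ → ℝ) (Δt Δx : ℝ) (q : ℕ → ℕ → ℝ) : Prop :=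
  ∀ n j : ℕ, q (n + 1) (j + 1) = q n (j + 1) - Δt / Δx *
    (godunovFlux f (q n (j + 1)) (q n (j + 2)) - godunovFlux f (q n j) (q n (j + 1)))

/-- The piecewise constant function of `z = (t, x)` that equals `q n j` on the cell
`[n Δt, (n + 1) Δt) × [j Δx, (j + 1) Δx)` for `n ≥ 0` and `j ≥ 1`, and vanishes outside the union
of these cells (for `Δt, Δx > 0`). -/
def stepFunction (Δt Δx : ℝ) (q : ℕ → ℕ → ℝ) (z : ℝ × ℝ) : ℝ :=
  if 0 ≤ z.1 ∧ Δx ≤ z.2 then q ⌊z.1 / Δt⌋₊ ⌊z.2 / Δx⌋₊ else 0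

end

/-! No bound on the variation of the data is available; compactness comes from strong convexity
through a discrete Oleinik estimate (`oleinik`): upward jumps between neighbouring cells are at most
`Δx * (A / t + β / x)`, where `β / x` absorbs the arbitrary boundary values. One time step lowers a
common bound `D` of such jumps by a multiple of `D ^ 2` (`update_le`), and `barrier_step` supplies a
barrier for this Riccati recursion.

By conservation, the cell values are space difference quotients of a discrete potential whose time
increments are fluxes (`exists_potential`). These potentials are uniformly Lipschitz, so a
subsequence converges to a Lipschitz `W`. If `Δx → 0`, the Oleinik bound squeezes each cell value
between difference quotients of the potential on its two sides, hence forces convergence wherever `W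
(t, ·)` is differentiable (`tendsto_cell_of_hasDerivAt`).

The meshes need not shrink. If `Δx` has a positive limit, cell values are quotients over a
convergent grid; if `Δx → ∞`, the functions vanish eventually at each point. -/

/-- Quantitative strong convexity of `f` on `[-M, M]` with slopes `s` bounded by `L`, and a
minimum point `θ` with quadratic growth. -/
structure ConvexData (f s : ℝ → ℝ) (δ M L θ : ℝ) : Prop where
  δ_pos : 0 < δ
  tangent : ∀ x ∈ Icc (-M) M, ∀ y ∈ Icc (-M) M, f x + s x * (y - x) + δ / 2 * (y - x) ^ 2 ≤ f y
  slope_le : ∀ x ∈ Icc (-M) M, |s x| ≤ L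
  mem : θ ∈ Icc (-M) M
  growth : ∀ y ∈ Icc (-M) M, f θ + δ / 4 * (y - θ) ^ 2 ≤ f y

/-! ### Strong convexity and the Godunov flux -/

namespace ConvexData

variable {f s : ℝ → ℝ} {δ M L θ : ℝ}

/-- Reflection exchanges the two monotone branches of `f`, which halves the later case analyses. -/
theorem reflect (h : ConvexData f s δ M L θ) :
    ConvexData (fun x => f (-x)) (fun x => -s (-x)) δ M L (-θ) where
  δ_pos := h.δ_pos
  tangent x hx y hy := by
    have := h.tangent (-x) ⟨by linarith [hx.2], by linarith [hx.1]⟩ (-y)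
      ⟨by linarith [hy.2], by linarith [hy.1]⟩
    nlinarith
  slope_le x hx := by
    rw [abs_neg]
    exact h.slope_le (-x) ⟨by linarith [hx.2], by linarith [hx.1]⟩
  mem := ⟨by linarith [h.mem.2], by linarith [h.mem.1]⟩
  growth y hy := by
    have := h.growth (-y) ⟨by linarith [hy.2], by linarith [hy.1]⟩
    simp only [neg_neg]
    nlinarith

theorem le_of_right (h : ConvexData f s δ M L θ) {x y : ℝ} (hy : y ∈ Icc (-M) M) (hx : θ ≤ x)
    (hxy : x ≤ y) : f x ≤ f y := by
  have hxm : x ∈ Icc (-M) M := ⟨h.mem.1.trans hx, hxy.trans hy.2⟩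
  have h1 := h.tangent x hxm y hy
  have h2 := h.tangent x hxm θ h.mem
  have h3 := h.growth x hxm
  rcases hx.eq_or_lt with rfl | hlt
  · have := h.growth y hy
    nlinarith [h.δ_pos, sq_nonneg (y - θ)]
  · have hs : 0 ≤ s x := by
      by_contra hc
      push Not at hc
      nlinarith [h.δ_pos, sq_nonneg (x - θ), mul_pos_of_neg_of_neg hc (sub_neg.2 hlt)]
    nlinarith [h.δ_pos, sq_nonneg (y - x), mul_nonneg hs (sub_nonneg.2 hxy)]

theorem le_of_left (h : ConvexData f s δ M L θ) {x y : ℝ} (hx : x ∈ Icc (-M) M) (hy : y ≤ θ)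
    (hxy : x ≤ y) : f y ≤ f x := by
  have := h.reflect.le_of_right (x := -y) (y := -x) ⟨by linarith [hx.2], by linarith [hx.1]⟩
    (by linarith) (by linarith)
  simpa using this

theorem min_le (h : ConvexData f s δ M L θ) {x : ℝ} (hx : x ∈ Icc (-M) M) : f θ ≤ f x := by
  have := h.growth x hx
  nlinarith [h.δ_pos, sq_nonneg (x - θ)]

/-- Since `f` decreases up to `θ` and increases after it, the flux splits into a part depending on
the left state alone and one depending on the right state alone. -/
theorem godunovFlux_eq (h : ConvexData f s δ M L θ) {p q : ℝ} (hp : p ∈ Icc (-M) M)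
    (hq : q ∈ Icc (-M) M) : godunovFlux f p q = max (f (max p θ)) (f (min q θ)) := by
  unfold godunovFlux
  split_ifs with hpq
  · have key : ∀ z ∈ Icc p q, (∀ y ∈ Icc p q, f z ≤ f y) → sInf (f '' Icc p q) = f z := by
      intro z hz hmin
      refine IsLeast.csInf_eq ⟨mem_image_of_mem f hz, ?_⟩
      rintro _ ⟨y, hy, rfl⟩
      exact hmin y hy
    have sub : ∀ y ∈ Icc p q, y ∈ Icc (-M) M := fun y hy => ⟨hp.1.trans hy.1, hy.2.trans hq.2⟩
    rcases le_total θ p with h1 | h1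
    · rw [max_eq_left h1, min_eq_right (h1.trans hpq), max_eq_left (h.min_le hp)]
      exact key p ⟨le_rfl, hpq⟩ fun y hy => h.le_of_right (sub y hy) h1 hy.1
    · rcases le_total θ q with h2 | h2
      · rw [max_eq_right h1, min_eq_right h2, max_self]
        exact key θ ⟨h1, h2⟩ fun y hy => h.min_le (sub y hy)
      · rw [max_eq_right h1, min_eq_left h2, max_eq_right (h.min_le hq)]
        exact key q ⟨hpq, le_rfl⟩ fun y hy => h.le_of_left (sub y hy) h2 hy.2
  · push Not at hpq
    have key : ∀ z ∈ Icc q p, (∀ y ∈ Icc q p, f y ≤ f z) → sSup (f '' Icc q p) = f z := by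
      intro z hz hmax
      refine IsGreatest.csSup_eq ⟨mem_image_of_mem f hz, ?_⟩
      rintro _ ⟨y, hy, rfl⟩
      exact hmax y hy
    have sub : ∀ y ∈ Icc q p, y ∈ Icc (-M) M := fun y hy => ⟨hq.1.trans hy.1, hy.2.trans hp.2⟩
    rcases le_total θ q with h1 | h1
    · rw [max_eq_left (h1.trans hpq.le), min_eq_right h1, max_eq_left (h.min_le hp)]
      exact key p ⟨hpq.le, le_rfl⟩ fun y hy => h.le_of_right hp (h1.trans hy.1) hy.2
    · rcases le_total θ p with h2 | h2
      · rw [max_eq_left h2, min_eq_left h1]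
        have bound : ∀ y ∈ Icc q p, f y ≤ max (f p) (f q) := by
          intro y hy
          rcases le_total θ y with h3 | h3
          · exact le_max_of_le_left (h.le_of_right hp h3 hy.2)
          · exact le_max_of_le_right (h.le_of_left hq h3 hy.1)
        rcases le_total (f p) (f q) with h4 | h4
        · rw [max_eq_right h4] at bound ⊢
          exact key q ⟨le_rfl, hpq.le⟩ bound
        · rw [max_eq_left h4] at bound ⊢
          exact key p ⟨hpq.le, le_rfl⟩ bound
      · rw [max_eq_right h2, min_eq_left h1, max_eq_right (h.min_le hq)]
        exact key q ⟨le_rfl, hpq.le⟩ fun y hy => h.le_of_left hq (hy.2.trans h2) hy.1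

/-! ### The discrete Oleinik estimate -/

/-- One-sided estimate of the updated difference when the middle flux is given by the left state. -/
theorem update_le_of_left_state (h : ConvexData f s δ M L θ) {lam D q₁ q₂ q₃ A B : ℝ}
    (hlam : 0 ≤ lam) (hL : lam * L ≤ 1 / 2) (hM : lam * δ * M ≤ 2)
    (h1 : q₁ ∈ Icc (-M) M) (h2 : q₂ ∈ Icc (-M) M) (h3 : q₃ ∈ Icc (-M) M)
    (hD0 : 0 ≤ D) (hD : D ≤ 4 * M) (h12 : q₂ - q₁ ≤ D) (h23 : q₃ - q₂ ≤ D)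
    (hflux : f (min q₃ θ) ≤ f (max q₂ θ))
    (hA : f (max q₃ θ) ≤ A) (hB : f (max q₁ θ) ≤ B) (hB' : f (min q₂ θ) ≤ B) :
    (q₃ - q₂) - lam * (A - 2 * f (max q₂ θ) + B) ≤ D - lam * (δ / 32) * D ^ 2 := by
  have hδ := h.δ_pos
  set a := lam * (δ / 32) with ha
  have ha0 : 0 ≤ a := by positivity
  have haM : a * M ≤ 1 / 16 := by rw [ha]; linarith
  have haD : a * D ≤ 1 / 4 := by nlinarith
  have hla : lam * δ = 32 * a := by rw [ha]; ring
  rcases le_or_gt q₂ θ with hq2 | hq2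
  -- Transonic case `q₂ ≤ θ ≤ q₃`: both outer fluxes exceed `f θ` quadratically.
  · rw [max_eq_right hq2] at hflux ⊢
    rw [min_eq_left hq2] at hB'
    have hq3 : θ ≤ q₃ := by
      by_contra hc
      push Not at hc
      rw [min_eq_left hc.le] at hflux
      have := h.growth q₃ h3
      have : 0 < δ / 4 * (q₃ - θ) ^ 2 := by
        have : q₃ - θ ≠ 0 := by linarith
        positivity
      linarith
    rw [max_eq_left hq3] at hA
    have g2 := h.growth q₂ h2
    have g3 := h.growth q₃ h3
    have e0 : 0 ≤ q₃ - q₂ := by linarith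
    have k1 : δ / 8 * (q₃ - q₂) ^ 2 ≤ A - 2 * f θ + B := by
      nlinarith [sq_nonneg ((q₃ - θ) - (θ - q₂))]
    have k2 := mul_le_mul_of_nonneg_left k1 hlam
    have k3 : lam * (δ / 8 * (q₃ - q₂) ^ 2) = 4 * (a * (q₃ - q₂) ^ 2) := by rw [ha]; ring
    have k4 : 0 ≤ a * (q₃ - q₂) ^ 2 := by positivity
    have k5 : a * (q₃ - q₂) ≤ a * D := mul_le_mul_of_nonneg_left h23 ha0
    have k6 : 0 ≤ (D - (q₃ - q₂)) * (1 - a * D - a * (q₃ - q₂)) :=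
      mul_nonneg (by linarith) (by linarith)
    linarith
  · rw [max_eq_left hq2.le] at hflux ⊢
    have hs0 : 0 ≤ s q₂ := by
      by_contra hc
      push Not at hc
      have := h.tangent q₂ h2 θ h.mem
      have := h.min_le h2
      nlinarith [sq_nonneg (θ - q₂), mul_pos_of_neg_of_neg hc (sub_neg.2 hq2)]
    have hsL : s q₂ ≤ L := (le_abs_self _).trans (h.slope_le q₂ h2)
    -- Convexity makes the loss of flux at most linear; clipping at `θ` only reduces it.
    have drop : ∀ y ∈ Icc (-M) M, f q₂ - f (max y θ) ≤ s q₂ * (q₂ - min y q₂) := by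
      intro y hy
      rcases le_total y θ with h4 | h4
      · rw [max_eq_right h4, min_eq_left (h4.trans hq2.le)]
        have := h.tangent q₂ h2 θ h.mem
        nlinarith [sq_nonneg (θ - q₂), mul_nonneg hs0 (sub_nonneg.2 h4)]
      · rw [max_eq_left h4]
        rcases le_total y q₂ with h5 | h5
        · rw [min_eq_left h5]
          have := h.tangent q₂ h2 y hy
          nlinarith [sq_nonneg (y - q₂)]
        · rw [min_eq_right h5]
          have := h.le_of_right hy hq2.le h5
          linarith
    have d1 : f q₂ - f (max q₁ θ) ≤ s q₂ * D := by
      refine (drop q₁ h1).trans (mul_le_mul_of_nonneg_left ?_ hs0)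
      rcases le_total q₁ q₂ with h5 | h5
      · rw [min_eq_left h5]; exact h12
      · rw [min_eq_right h5]; linarith
    have hls0 : 0 ≤ lam * s q₂ := mul_nonneg hlam hs0
    have hls : lam * s q₂ ≤ 1 / 2 := (mul_le_mul_of_nonneg_left hsL hlam).trans hL
    -- For `q₂ ≤ q₃` the update is at most a convex combination of `q₃ - q₂` and `D`, of weight `lam
    -- * s q₂ ≤ 1 / 2`, minus a quadratic gain. Otherwise it is at most `D / 2`, which suffices as
    -- `a * D ≤ 1 / 4`.
    rcases le_total q₂ q₃ with h5 | h5
    · rw [max_eq_left (hq2.le.trans h5)] at hA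
      have t := h.tangent q₂ h2 q₃ h3
      have k1 : s q₂ * (q₃ - q₂) + δ / 2 * (q₃ - q₂) ^ 2 - s q₂ * D ≤ A - 2 * f q₂ + B := by
        linarith
      have k2 := mul_le_mul_of_nonneg_left k1 hlam
      have k3 : lam * (s q₂ * (q₃ - q₂) + δ / 2 * (q₃ - q₂) ^ 2 - s q₂ * D)
          = lam * s q₂ * (q₃ - q₂) + 16 * (a * (q₃ - q₂) ^ 2) - lam * s q₂ * D := by rw [ha]; ring
      have k4 : 0 ≤ a * (q₃ - q₂) ^ 2 := by positivity
      have k5 : a * (q₃ - q₂) ≤ a * D := mul_le_mul_of_nonneg_left h23 ha0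
      have k6 : 0 ≤ (D - (q₃ - q₂)) * (1 - lam * s q₂ - a * D - a * (q₃ - q₂)) :=
        mul_nonneg (by linarith) (by linarith)
      linarith
    · have d3 := drop q₃ h3
      rw [min_eq_left h5] at d3
      have k1 : -(s q₂ * (q₂ - q₃)) - s q₂ * D ≤ A - 2 * f q₂ + B := by linarith
      have k2 := mul_le_mul_of_nonneg_left k1 hlam
      have k3 : 0 ≤ (q₂ - q₃) * (1 - lam * s q₂) := mul_nonneg (by linarith) (by linarith)
      have k4 : lam * s q₂ * D ≤ 1 / 2 * D := mul_le_mul_of_nonneg_right hls hD0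
      have k5 : a * D * D ≤ 1 / 4 * D := mul_le_mul_of_nonneg_right haD hD0
      linarith

/-- Decay of differences bounded by `D` after one step of the scheme. -/
theorem update_le (h : ConvexData f s δ M L θ) {lam D q₁ q₂ q₃ q₄ : ℝ}
    (hlam : 0 ≤ lam) (hL : lam * L ≤ 1 / 2) (hM : lam * δ * M ≤ 2)
    (h1 : q₁ ∈ Icc (-M) M) (h2 : q₂ ∈ Icc (-M) M) (h3 : q₃ ∈ Icc (-M) M) (h4 : q₄ ∈ Icc (-M) M)
    (hD0 : 0 ≤ D) (hD : D ≤ 4 * M) (h12 : q₂ - q₁ ≤ D) (h23 : q₃ - q₂ ≤ D) (h34 : q₄ - q₃ ≤ D) :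
    (q₃ - q₂) - lam * (godunovFlux f q₃ q₄ - 2 * godunovFlux f q₂ q₃ + godunovFlux f q₁ q₂)
      ≤ D - lam * (δ / 32) * D ^ 2 := by
  rw [h.godunovFlux_eq h3 h4, h.godunovFlux_eq h2 h3, h.godunovFlux_eq h1 h2]
  have hneg : ∀ x ∈ Icc (-M) M, -x ∈ Icc (-M) M := fun x hx =>
    ⟨by linarith [hx.2], by linarith [hx.1]⟩
  have e1 : ∀ x : ℝ, -max (-x) (-θ) = min x θ := fun x => by rw [max_neg_neg, neg_neg]
  have e2 : ∀ x : ℝ, -min (-x) (-θ) = max x θ := fun x => by rw [min_neg_neg, neg_neg]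
  rcases le_total (f (min q₃ θ)) (f (max q₂ θ)) with hc | hc
  · rw [max_eq_left hc]
    exact h.update_le_of_left_state hlam hL hM h1 h2 h3 hD0 hD h12 h23 hc (le_max_left _ _)
      (le_max_left _ _) (le_max_right _ _)
  · rw [max_eq_right hc]
    -- Reflecting and reversing the order of the cells turns the right state into a left state.
    have := h.reflect.update_le_of_left_state (q₁ := -q₄) (q₂ := -q₃) (q₃ := -q₂) (D := D)
      (A := max (f (max q₁ θ)) (f (min q₂ θ))) (B := max (f (max q₃ θ)) (f (min q₄ θ)))
      hlam hL hM (hneg _ h4) (hneg _ h3) (hneg _ h2) hD0 hD (by linarith) (by linarith)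
      (by simpa only [e1, e2] using hc) (by simp only [e1]; exact le_max_right _ _)
      (by simp only [e1]; exact le_max_right _ _) (by simp only [e2]; exact le_max_left _ _)
    simp only [e1] at this
    linarith

theorem godunovFlux_lipschitz_left (h : ConvexData f s δ M L θ) {p p' q : ℝ}
    (hlip : ∀ x ∈ Icc (-M) M, ∀ y ∈ Icc (-M) M, |f x - f y| ≤ L * |x - y|)
    (hp : p ∈ Icc (-M) M) (hp' : p' ∈ Icc (-M) M) (hq : q ∈ Icc (-M) M) :
    godunovFlux f p' q - godunovFlux f p q ≤ L * |p' - p| := by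
  rw [h.godunovFlux_eq hp hq, h.godunovFlux_eq hp' hq]
  have hm : ∀ x ∈ Icc (-M) M, max x θ ∈ Icc (-M) M := fun x hx =>
    ⟨hx.1.trans (le_max_left _ _), max_le hx.2 h.mem.2⟩
  have hL0 : 0 ≤ L := (abs_nonneg _).trans (h.slope_le θ h.mem)
  calc _ ≤ |max (f (max p' θ)) (f (min q θ)) - max (f (max p θ)) (f (min q θ))| := le_abs_self _
    _ ≤ |f (max p' θ) - f (max p θ)| := abs_max_sub_max_le_abs _ _ _
    _ ≤ L * |max p' θ - max p θ| := hlip _ (hm _ hp') _ (hm _ hp)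
    _ ≤ L * |p' - p| := mul_le_mul_of_nonneg_left (abs_max_sub_max_le_abs _ _ _) hL0

/-- The barrier `α / N + β / J` is a supersolution of the recursion for the differences. -/
theorem barrier_step {α β lam c L N J : ℝ} (hα : 0 ≤ α) (hβ : 0 ≤ β) (hlam : 0 ≤ lam) (hL : 0 ≤ L)
    (hN : 1 ≤ N) (hJ : 1 ≤ J) (hc : 0 ≤ c) (hcα : lam * c * α = 1) (hcβ : 2 * L ≤ c * β) :
    (α / N + β / (J + 1)) - lam * c * (α / N + β / (J + 1)) ^ 2 +
      lam * (L * (β / J - β / (J + 1))) ≤ α / (N + 1) + β / (J + 1) := by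
  have w1 : L * (β / J - β / (J + 1)) ≤ c * (β / (J + 1)) ^ 2 := by
    have : β / J - β / (J + 1) ≤ 2 * (β / (J + 1) ^ 2) := by
      rw [div_sub_div _ _ (by positivity) (by positivity), ← mul_div_assoc,
        div_le_div_iff₀ (by positivity) (by positivity)]
      have : 0 ≤ β * (J + 1) * (J - 1) := by
        have : 0 ≤ J - 1 := by linarith
        positivity
      linarith
    calc _ ≤ L * (2 * (β / (J + 1) ^ 2)) := mul_le_mul_of_nonneg_left this hL
      _ = (2 * L) * (β / (J + 1) ^ 2) := by ring
      _ ≤ (c * β) * (β / (J + 1) ^ 2) := by gcongr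
      _ = _ := by rw [div_pow]; ring
  have w2 : α / N - α / (N + 1) ≤ lam * c * (α / N) ^ 2 := by
    have : lam * c * (α / N) ^ 2 = α / N ^ 2 := by
      rw [div_pow, pow_two α, ← mul_div_assoc, ← mul_assoc, hcα, one_mul]
    rw [this, div_sub_div _ _ (by positivity) (by positivity),
      div_le_div_iff₀ (by positivity) (by positivity)]
    have : 0 ≤ α * N := by positivity
    linarith
  have w3 : 0 ≤ lam * c * (2 * (α / N) * (β / (J + 1))) := by positivity
  have w1' := mul_le_mul_of_nonneg_left w1 hlam
  linarith

/-- One-sided Lipschitz (Oleinik) estimate for the Godunov scheme in the quarter plane. -/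
theorem oleinik (h : ConvexData f s δ M L θ)
    (hlip : ∀ x ∈ Icc (-M) M, ∀ y ∈ Icc (-M) M, |f x - f y| ≤ L * |x - y|)
    {dt dx : ℝ} (hdt : 0 < dt) (hdx : 0 < dx) (hM0 : 0 < M)
    (hL : dt / dx * L ≤ 1 / 2) (hM : dt / dx * δ * M ≤ 2) {q : ℕ → ℕ → ℝ}
    (hq : IsGodunovSolution f dt dx q) (hb : ∀ n j, q n j ∈ Icc (-M) M) (n j : ℕ) :
    q (n + 1) (j + 2) - q (n + 1) (j + 1) ≤
      32 / (δ * (dt / dx)) / (n + 1) + (64 * L / δ + 2 * M) / (j + 1) := by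
  have hδ := h.δ_pos
  have hL0 : 0 ≤ L := (abs_nonneg _).trans (h.slope_le θ h.mem)
  set lam := dt / dx with hlam
  have hlam0 : 0 < lam := div_pos hdt hdx
  set α := 32 / (δ * lam) with hα
  set β := 64 * L / δ + 2 * M with hβ
  have hα0 : 0 < α := by positivity
  have hβ0 : 0 < β := by positivity
  have hαM : 2 * M ≤ α := by
    rw [hα, le_div_iff₀ (by positivity)]
    nlinarith
  have hβM : 2 * M ≤ β := by
    have : 0 ≤ 64 * L / δ := by positivity
    linarith
  have hcα : lam * (δ / 32) * α = 1 := by rw [hα]; field_simp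
  have hcβ : 2 * L ≤ δ / 32 * β := by
    have : δ / 32 * β = 2 * L + δ / 32 * (2 * M) := by rw [hβ]; field_simp; ring
    rw [this]
    nlinarith [mul_pos hδ hM0]
  have hdiff : ∀ n i k, q n i - q n k ≤ 2 * M := fun n i k => by
    linarith [(hb n i).2, (hb n k).1]
  induction n generalizing j with
  | zero =>
    have := hdiff (0 + 1) (j + 2) (j + 1)
    have : 0 ≤ β / ((j : ℝ) + 1) := by positivity
    simp only [Nat.cast_zero, zero_add, div_one] at *
    linarith
  | succ n ih =>
    have hN : (0 : ℝ) < (n : ℝ) + 1 := by positivity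
    rcases j with _ | j
    -- Next to the boundary the left jump is uncontrolled, but `β ≥ 2 * M` makes the bound trivial.
    · have := hdiff (n + 1 + 1) (0 + 2) (0 + 1)
      have : 0 ≤ α / (((n + 1 : ℕ) : ℝ) + 1) := by positivity
      simp only [Nat.cast_zero, zero_add, div_one] at *
      linarith
    · push_cast
      set N : ℝ := (n : ℝ) + 1 with hNdef
      set J : ℝ := (j : ℝ) + 1 with hJdef
      have hJ : 1 ≤ J := by rw [hJdef]; linarith [(Nat.cast_nonneg j : (0 : ℝ) ≤ j)]
      have hJ0 : 0 < J := by linarith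
      have hN1 : 1 ≤ N := by rw [hNdef]; linarith [(Nat.cast_nonneg n : (0 : ℝ) ≤ n)]
      set D := α / N + β / (J + 1) with hD
      have hD0 : 0 ≤ D := by positivity
      have i1 : q (n + 1) (j + 2) - q (n + 1) (j + 1) ≤ α / N + β / J := ih j
      have i2 : q (n + 1) (j + 3) - q (n + 1) (j + 2) ≤ D := by
        have := ih (j + 1)
        push_cast at this
        exact this
      have i3 : q (n + 1) (j + 4) - q (n + 1) (j + 3) ≤ D := by
        refine (ih (j + 2)).trans ?_
        rw [hD]
        gcongr
        push_cast
        linarith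
      rcases le_or_gt D (4 * M) with hDM | hDM
      -- The left jump only obeys the weaker bound with `β / J`. Raising the left state to `q'`
      -- restores the common bound `D`, at a flux cost of at most `L * (β / J - β / (J + 1))`.
      · set q' := max (q (n + 1) (j + 1)) (q (n + 1) (j + 2) - D) with hq'
        have hq'm : q' ∈ Icc (-M) M :=
          ⟨(hb _ _).1.trans (le_max_left _ _), max_le (hb _ _).2 (by linarith [(hb (n + 1) (j + 2)).2])⟩
        have hq'D : q (n + 1) (j + 2) - q' ≤ D := by
          linarith [le_max_right (q (n + 1) (j + 1)) (q (n + 1) (j + 2) - D)]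
        have key := h.update_le hlam0.le hL hM hq'm (hb (n + 1) (j + 2)) (hb (n + 1) (j + 3))
          (hb (n + 1) (j + 4)) hD0 hDM hq'D i2 i3
        have pert := h.godunovFlux_lipschitz_left hlip (hb (n + 1) (j + 1)) hq'm (hb (n + 1) (j + 2))
        have hgap : |q' - q (n + 1) (j + 1)| ≤ β / J - β / (J + 1) := by
          have hg0 : 0 ≤ β / J - β / (J + 1) := by
            rw [sub_nonneg]
            gcongr
            linarith
          rw [abs_of_nonneg (sub_nonneg.2 (le_max_left _ _)), sub_le_iff_le_add]
          refine max_le (by linarith) ?_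
          rw [hD]
          linarith
        have u1 := hq (n + 1) (j + 1)
        have u2 := hq (n + 1) (j + 2)
        rw [← hlam] at u1 u2
        have v1 : lam * (godunovFlux f q' (q (n + 1) (j + 2)) -
            godunovFlux f (q (n + 1) (j + 1)) (q (n + 1) (j + 2)))
            ≤ lam * (L * (β / J - β / (J + 1))) :=
          mul_le_mul_of_nonneg_left (pert.trans (mul_le_mul_of_nonneg_left hgap hL0)) hlam0.le
        have w := barrier_step hα0.le hβ0.le hlam0.le hL0 hN1 hJ (by positivity) hcα hcβ
        rw [← hD] at w
        linarith only [u1, u2, v1, w, key]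
      -- The barrier at most halves in one step, so it still exceeds the trivial bound `2 * M`.
      · have d := hdiff (n + 1 + 1) (j + 1 + 2) (j + 1 + 1)
        have : α / N / 2 ≤ α / (N + 1) := by
          rw [div_div]
          gcongr
          linarith
        have : 0 ≤ β / (J + 1) := by positivity
        linarith

end ConvexData

theorem exists_convexData {f : ℝ → ℝ} {δ M : ℝ} {L : ℝ≥0} (hf : ContDiff ℝ 2 f) (hδ : 0 < δ)
    (hM : 0 < M) (hconv : ∀ x ∈ Icc (-M) M, δ ≤ deriv (deriv f) x)
    (hL : LipschitzOnWith L f (Icc (-M) M)) : ∃ θ, ConvexData f (deriv f) δ M L θ := by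
  have hd : Differentiable ℝ f := hf.differentiable (by norm_num)
  have hf' : ContDiff ℝ 1 (deriv f) := hf.deriv'
  have hd' : Differentiable ℝ (deriv f) := hf'.differentiable (by norm_num)
  have tangent : ∀ x ∈ Icc (-M) M, ∀ y ∈ Icc (-M) M,
      f x + deriv f x * (y - x) + δ / 2 * (y - x) ^ 2 ≤ f y := by
    -- Removing the parabola leaves a convex function, whose tangent inequality is the claim.
    set h : ℝ → ℝ := fun x => f x - δ / 2 * x ^ 2 with hh
    have h1 : ∀ x, HasDerivAt h (deriv f x - δ * x) x := fun x => by
      have := (hd x).hasDerivAt.sub (((hasDerivAt_id x).pow 2).const_mul (δ / 2))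
      refine this.congr_deriv ?_
      simp
      ring
    have h1' : deriv h = fun x => deriv f x - δ * x := funext fun x => (h1 x).deriv
    have h2 : ∀ x, HasDerivAt (deriv h) (deriv (deriv f) x - δ) x := fun x => by
      rw [h1']
      exact ((hd' x).hasDerivAt.sub ((hasDerivAt_id x).const_mul δ)).congr_deriv (by simp)
    have hc : ConvexOn ℝ (Icc (-M) M) h := by
      refine convexOn_of_deriv2_nonneg (convex_Icc _ _)
        (fun x _ => (h1 x).continuousAt.continuousWithinAt)
        (fun x _ => (h1 x).differentiableAt.differentiableWithinAt)
        (fun x _ => (h2 x).differentiableAt.differentiableWithinAt) fun x hx => ?_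
      rw [interior_Icc] at hx
      simp only [Function.iterate_succ, Function.iterate_zero, Function.comp_apply, id]
      rw [(h2 x).deriv]
      linarith [hconv x (Ioo_subset_Icc_self hx)]
    intro x hx y hy
    have key : h x + (deriv f x - δ * x) * (y - x) ≤ h y := by
      rcases lt_trichotomy x y with hxy | rfl | hxy
      · have := hc.le_slope_of_hasDerivAt hx hy hxy (h1 x)
        rw [slope_def_field, le_div_iff₀ (by linarith)] at this
        linarith
      · simp
      · have := hc.slope_le_of_hasDerivAt hy hx hxy (h1 x)
        rw [slope_def_field, div_le_iff₀ (by linarith)] at this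
        linarith
    simp only [hh] at key
    nlinarith
  have slope : ∀ x ∈ Icc (-M) M, |deriv f x| ≤ L := by
    have hcl : IsClosed {x | |deriv f x| ≤ L} := isClosed_le hf'.continuous.abs continuous_const
    have hsub : Ioo (-M) M ⊆ {x | |deriv f x| ≤ L} := fun x hx =>
      norm_deriv_le_of_lipschitzOn (Icc_mem_nhds hx.1 hx.2) hL
    have := hcl.closure_subset_iff.2 hsub
    rw [closure_Ioo (by linarith)] at this
    exact this
  obtain ⟨θ, hθ, hmin⟩ := isCompact_Icc.exists_isMinOn (nonempty_Icc.2 (by linarith : -M ≤ M))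
    hd.continuous.continuousOn
  refine ⟨θ, hδ, tangent, slope, hθ, fun y hy => ?_⟩
  -- Tangents at the midpoint avoid any use of `deriv f θ = 0`, which may fail if `θ` is an
  -- endpoint; this gives the constant `δ / 4`.
  have hm : (θ + y) / 2 ∈ Icc (-M) M := ⟨by linarith [hθ.1, hy.1], by linarith [hθ.2, hy.2]⟩
  have t1 := tangent _ hm y hy
  have t2 := tangent _ hm θ hθ
  have t3 : f θ ≤ f ((θ + y) / 2) := hmin hm
  nlinarith

/-! ### Compactness and extension of Lipschitz functions -/

theorem tendsto_apply_of_lipschitz {X : Type*} [PseudoMetricSpace X] {K : ℝ≥0} {V : ℕ → X → ℝ}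
    {W : X → ℝ} (hV : ∀ k, LipschitzWith K (V k)) {z : X}
    (hW : Tendsto (fun k => V k z) atTop (𝓝 (W z))) {u : ℕ → X} (hu : Tendsto u atTop (𝓝 z)) :
    Tendsto (fun k => V k (u k)) atTop (𝓝 (W z)) := by
  refine hW.congr_dist ?_
  have h0 : Tendsto (fun k => (K : ℝ) * dist z (u k)) atTop (𝓝 0) := by
    have : Tendsto (fun k => dist z (u k)) atTop (𝓝 0) := by
      simpa using (tendsto_const_nhds (x := z)).dist hu
    simpa using this.const_mul (K : ℝ)
  exact squeeze_zero (fun _ => dist_nonneg) (fun k => (hV k).dist_le_mul _ _) h0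

/-- Tychonoff gives convergence on a dense sequence; equicontinuity extends it to every point. -/
theorem exists_subseq_tendsto_of_lipschitz {X : Type*} [PseudoMetricSpace X]
    [TopologicalSpace.SeparableSpace X] (x₀ : X) {K : ℝ≥0} {V : ℕ → X → ℝ}
    (hV : ∀ k, LipschitzWith K (V k)) (h0 : ∀ k, V k x₀ = 0) :
    ∃ φ : ℕ → ℕ, StrictMono φ ∧ ∃ W : X → ℝ, LipschitzWith K W ∧
      ∀ z, Tendsto (fun k => V (φ k) z) atTop (𝓝 (W z)) := by
  have : Nonempty X := ⟨x₀⟩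
  set d := TopologicalSpace.denseSeq X
  have hcpt : IsCompact (Set.pi univ fun i : ℕ => Icc (-(K * dist (d i) x₀)) (K * dist (d i) x₀)) :=
    isCompact_univ_pi fun i => isCompact_Icc
  obtain ⟨a, -, φ, hφ, ha⟩ := hcpt.tendsto_subseq (x := fun k i => V k (d i)) fun k i _ => by
    have := (hV k).dist_le_mul (d i) x₀
    rw [h0, Real.dist_eq, sub_zero] at this
    exact abs_le.1 this
  rw [tendsto_pi_nhds] at ha
  have hlim : ∀ z, ∃ w, Tendsto (fun k => V (φ k) z) atTop (𝓝 w) := by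
    intro z
    refine cauchySeq_tendsto_of_complete (Metric.cauchySeq_iff'.2 fun ε hε => ?_)
    obtain ⟨i, hi⟩ : ∃ i, dist z (d i) < ε / (4 * (K + 1)) :=
      (TopologicalSpace.denseRange_denseSeq X).exists_dist_lt z (by positivity)
    have hK : (K : ℝ) * dist z (d i) < ε / 4 := by
      rw [lt_div_iff₀ (by positivity)] at hi
      nlinarith [dist_nonneg (x := z) (y := d i), K.2]
    obtain ⟨N, hN⟩ := Metric.cauchySeq_iff'.1 (ha i).cauchySeq (ε / 4) (by linarith)
    refine ⟨N, fun n hn => ?_⟩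
    have h1 := (hV (φ n)).dist_le_mul z (d i)
    have h2 := (hV (φ N)).dist_le_mul z (d i)
    have h3 : dist (V (φ n) (d i)) (V (φ N) (d i)) < ε / 4 := hN n hn
    have h4 := dist_triangle4 (V (φ n) z) (V (φ n) (d i)) (V (φ N) (d i)) (V (φ N) z)
    rw [dist_comm (V (φ N) (d i))] at h4
    linarith
  choose W hW using hlim
  refine ⟨φ, hφ, W, LipschitzWith.of_dist_le_mul fun x y => ?_, hW⟩
  exact le_of_tendsto ((hW x).dist (hW y)) (Eventually.of_forall fun k => (hV (φ k)).dist_le_mul x y)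

theorem abs_sub_le_of_abs_succ_sub_le {a : ℕ → ℝ} {C : ℝ} (h : ∀ n, |a (n + 1) - a n| ≤ C)
    (n m : ℕ) : |a n - a m| ≤ C * |(n : ℝ) - m| := by
  wlog hnm : m ≤ n generalizing n m
  · rw [abs_sub_comm, abs_sub_comm (n : ℝ)]
    exact this m n (by omega)
  induction n, hnm using Nat.le_induction with
  | base => simp
  | succ n hmn ih =>
    have h1 : (m : ℝ) ≤ n := by exact_mod_cast hmn
    rw [abs_of_nonneg (sub_nonneg.2 h1)] at ih
    push_cast
    rw [abs_of_nonneg (by linarith : (0 : ℝ) ≤ n + 1 - m)]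
    calc |a (n + 1) - a m| ≤ |a (n + 1) - a n| + |a n - a m| := abs_sub_le _ _ _
      _ ≤ C + C * (n - m) := add_le_add (h n) ih
      _ = _ := by ring

/-- The sup distance dominates both coordinate distances, so the potential is Lipschitz on the
lattice and extends to the plane with the same constant. -/
theorem exists_lipschitz_extension_of_lattice {dt dx : ℝ} (hdt : 0 < dt) (hdx : 0 < dx)
    {S : ℕ → ℕ → ℝ} {F M : ℝ≥0} (ht : ∀ n j, |S (n + 1) j - S n j| ≤ F * dt)
    (hx : ∀ n j, |S n (j + 1) - S n j| ≤ M * dx) :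
    ∃ V : ℝ × ℝ → ℝ, LipschitzWith (F + M) V ∧ ∀ n j : ℕ, V (n * dt, j * dx) = S n j := by
  set e : ℕ × ℕ → ℝ × ℝ := fun p => (p.1 * dt, p.2 * dx) with he
  have hinj : Function.Injective e := by
    rintro ⟨n, j⟩ ⟨m, i⟩ h
    simpa [he, hdt.ne', hdx.ne'] using h
  set S' : ℝ × ℝ → ℝ := Function.extend e (fun p => S p.1 p.2) 0 with hS'
  have happ : ∀ p, S' (e p) = S p.1 p.2 := fun p => hinj.extend_apply _ _ p
  have hlip : LipschitzOnWith (F + M) S' (range e) := by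
    refine LipschitzOnWith.of_dist_le_mul ?_
    rintro _ ⟨⟨n, j⟩, rfl⟩ _ ⟨⟨m, i⟩, rfl⟩
    rw [happ, happ, Real.dist_eq]
    have h1 := abs_sub_le_of_abs_succ_sub_le (a := fun k => S k j) (fun k => ht k j) n m
    have h2 := abs_sub_le_of_abs_succ_sub_le (hx m) j i
    have h3 : |(n : ℝ) - m| * dt ≤ dist (e (n, j)) (e (m, i)) := by
      refine le_trans (le_of_eq ?_) (le_max_left _ _)
      simp only [he]
      rw [Real.dist_eq, ← sub_mul, abs_mul, abs_of_pos hdt]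
    have h4 : |(j : ℝ) - i| * dx ≤ dist (e (n, j)) (e (m, i)) := by
      refine le_trans (le_of_eq ?_) (le_max_right _ _)
      simp only [he]
      rw [Real.dist_eq, ← sub_mul, abs_mul, abs_of_pos hdx]
    have h5 := mul_le_mul_of_nonneg_left h3 F.2
    have h6 := mul_le_mul_of_nonneg_left h4 M.2
    have h7 := abs_sub_le (S n j) (S m j) (S m i)
    simp only [NNReal.val_eq_coe] at h5 h6
    push_cast
    linarith
  obtain ⟨V, hV, heq⟩ := hlip.extend_real
  exact ⟨V, hV, fun n j => by rw [← happ (n, j)]; exact (heq (mem_range_self (n, j))).symm⟩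

/-! ### Potentials and convergence of the cell values -/

/-- A discrete primitive of a solution of the Godunov scheme: its space increments are the cell
averages, its time increments are the fluxes. -/
theorem exists_potential {f : ℝ → ℝ} {dt dx : ℝ} (hdx : 0 < dx) {q : ℕ → ℕ → ℝ}
    (hq : IsGodunovSolution f dt dx q) :
    ∃ S : ℕ → ℕ → ℝ, S 0 0 = 0 ∧ (∀ n j, S n (j + 1) - S n j = dx * q n (j + 1)) ∧
      ∀ n j, S (n + 1) j - S n j = -(dt * godunovFlux f (q n j) (q n (j + 1))) := by
  refine ⟨fun n j => ∑ i ∈ Finset.range j, dx * q n (i + 1)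
    - ∑ m ∈ Finset.range n, dt * godunovFlux f (q m 0) (q m 1), by simp, fun n j => ?_,
    fun n j => ?_⟩
  · simp only [Finset.sum_range_succ]
    ring
  · induction j with
    | zero => simp [Finset.sum_range_succ]
    -- Passing to the next cell, compatibility of the two increments is the scheme itself.
    | succ j ih =>
      simp only [Finset.sum_range_succ] at ih ⊢
      have h1 : dx * q (n + 1) (j + 1) = dx * q n (j + 1) - dt *
          (godunovFlux f (q n (j + 1)) (q n (j + 2)) - godunovFlux f (q n j) (q n (j + 1))) := by
        rw [hq n j]
        field_simp
      linarith

/-- A bound on upward jumps alone controls the averages to the right of a cell from above;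
`le_partial_sum` controls those to its left from below. -/
theorem partial_sum_le {a S : ℕ → ℝ} {dx C : ℝ} (hdx : 0 ≤ dx) (hC : 0 ≤ C)
    (hS : ∀ i, S (i + 1) - S i = dx * a (i + 1)) {p : ℕ}
    (ha : ∀ l, p + 1 ≤ l → a (l + 1) ≤ a l + C * dx) (m : ℕ) :
    S (p + m) - S p ≤ m * dx * (a (p + 1) + C * (m * dx)) := by
  have hinc : ∀ l : ℕ, a (p + 1 + l) ≤ a (p + 1) + C * (l * dx) := by
    intro l
    induction l with
    | zero => simp
    | succ l ih =>
      have := ha (p + 1 + l) (by omega)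
      rw [← add_assoc]
      push_cast
      linarith
  induction m with
  | zero => simp
  | succ m ih =>
    have h1 := hS (p + m)
    have h2 := mul_le_mul_of_nonneg_left (hinc m) hdx
    rw [show p + 1 + m = p + m + 1 by omega] at h2
    rw [← add_assoc]
    push_cast
    have h3 : 0 ≤ C * dx * dx * (m + 1) := by positivity
    linarith

theorem le_partial_sum {a S : ℕ → ℝ} {dx C : ℝ} (hdx : 0 ≤ dx) (hC : 0 ≤ C)
    (hS : ∀ i, S (i + 1) - S i = dx * a (i + 1)) {p : ℕ}
    (ha : ∀ l, p + 1 ≤ l → a (l + 1) ≤ a l + C * dx) (m : ℕ) :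
    m * dx * (a (p + m + 1) - C * (m * dx)) ≤ S (p + m) - S p := by
  induction m with
  | zero => simp
  | succ m ih =>
    have h1 := hS (p + m)
    have h2 := ha (p + m + 1) (by omega)
    rw [← add_assoc p]
    push_cast
    have h3 : (m + 1) * dx * a (p + m + 1 + 1) ≤ (m + 1) * dx * (a (p + m + 1) + C * dx) :=
      mul_le_mul_of_nonneg_left h2 (by positivity)
    have h4 : 0 ≤ C * dx * dx * m := by positivity
    linarith

theorem tendsto_floor_div_mul {d : ℕ → ℝ} (hd : ∀ k, 0 < d k) (h0 : Tendsto d atTop (𝓝 0)) {t : ℝ}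
    (ht : 0 ≤ t) : Tendsto (fun k => (⌊t / d k⌋₊ : ℝ) * d k) atTop (𝓝 t) := by
  have h1 : Tendsto (fun k => t - d k) atTop (𝓝 t) := by simpa using h0.const_sub t
  refine tendsto_of_tendsto_of_tendsto_of_le_of_le h1 tendsto_const_nhds (fun k => ?_) fun k => ?_
  · have := (div_lt_iff₀ (hd k)).1 (Nat.lt_floor_add_one (t / d k))
    simp only
    linarith
  · exact (le_div_iff₀ (hd k)).1 (Nat.floor_le (div_nonneg ht (hd k).le))

theorem eventually_floor_div_eq {d : ℕ → ℝ} {a t : ℝ} (ha : 0 < a) (h : Tendsto d atTop (𝓝 a))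
    (ht : 0 ≤ t) (hne : ∀ n : ℕ, t ≠ n * a) : ∀ᶠ k in atTop, ⌊t / d k⌋₊ = ⌊t / a⌋₊ := by
  have hdiv : Tendsto (fun k => t / d k) atTop (𝓝 (t / a)) := tendsto_const_nhds.div h ha.ne'
  have h1 : (⌊t / a⌋₊ : ℝ) < t / a := by
    refine lt_of_le_of_ne (Nat.floor_le (div_nonneg ht ha.le)) fun heq => hne ⌊t / a⌋₊ ?_
    rw [heq]
    field_simp
  filter_upwards [hdiv.eventually_const_lt h1, hdiv.eventually_lt_const (Nat.lt_floor_add_one _)]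
    with k hk1 hk2
  exact (Nat.floor_eq_iff ((Nat.cast_nonneg _).trans hk1.le)).2 ⟨hk1.le, hk2⟩

/-- Where the limit potential is differentiable in space, the cell averages converge, thanks to
the one-sided Lipschitz estimate. -/
theorem tendsto_cell_of_hasDerivAt {dt dx : ℕ → ℝ} (hdt : ∀ k, 0 < dt k) (hdx : ∀ k, 0 < dx k)
    (hdt0 : Tendsto dt atTop (𝓝 0)) (hdx0 : Tendsto dx atTop (𝓝 0)) {q S : ℕ → ℕ → ℕ → ℝ}
    {V : ℕ → ℝ × ℝ → ℝ} {W : ℝ × ℝ → ℝ} {K : ℝ≥0} {A β : ℝ} (hA : 0 ≤ A) (hβ : 0 ≤ β)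
    (hV : ∀ k, LipschitzWith K (V k))
    (hVS : ∀ k (n j : ℕ), V k (n * dt k, j * dx k) = S k n j)
    (hS : ∀ k n j, S k n (j + 1) - S k n j = dx k * q k n (j + 1))
    (hO : ∀ k (n j : ℕ), q k (n + 1) (j + 2) - q k (n + 1) (j + 1) ≤
      dx k * (A / ((n + 1) * dt k) + β / ((j + 1) * dx k)))
    (hW : ∀ z, Tendsto (fun k => V k z) atTop (𝓝 (W z))) {t x D : ℝ} (ht : 0 < t) (hx : 0 < x)
    (hD : HasDerivAt (fun y => W (t, y)) D x) :
    Tendsto (fun k => q k ⌊t / dt k⌋₊ ⌊x / dx k⌋₊) atTop (𝓝 D) := by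
  set N : ℕ → ℕ := fun k => ⌊t / dt k⌋₊ with hNdef
  set J : ℕ → ℕ := fun k => ⌊x / dx k⌋₊ with hJdef
  have hN : Tendsto (fun k => (N k : ℝ) * dt k) atTop (𝓝 t) := tendsto_floor_div_mul hdt hdt0 ht.le
  have hJ : Tendsto (fun k => (J k : ℝ) * dx k) atTop (𝓝 x) := tendsto_floor_div_mul hdx hdx0 hx.le
  -- One-sided Lipschitz constant valid for times above `t / 2` and positions above `x / 4`.
  set C := A / (t / 2) + β / (x / 4) with hCdef
  have hC : 0 ≤ C := by positivity
  refine Metric.tendsto_nhds.2 fun ε hε => ?_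
  obtain ⟨r, hr, hslope⟩ : ∃ r > 0, ∀ u : ℝ, |u| < r → u ≠ 0 →
      |u⁻¹ * (W (t, x + u) - W (t, x)) - D| < ε / 4 := by
    have := Metric.tendsto_nhds.1 hD.tendsto_slope_zero (ε / 4) (by linarith)
    rw [eventually_nhdsWithin_iff, Metric.eventually_nhds_iff] at this
    obtain ⟨r, hr, h⟩ := this
    refine ⟨r, hr, fun u hu hu0 => ?_⟩
    have := h (y := u) (by simpa [Real.dist_eq] using hu) hu0
    simpa [Real.dist_eq] using this
  set h := min (r / 2) (min (x / 8) (ε / (4 * (C + 1)))) with hh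
  have h0 : 0 < h := by positivity
  have hhr : h < r := (min_le_left _ _).trans_lt (by linarith)
  have hhx : h ≤ x / 8 := (min_le_right _ _).trans (min_le_left _ _)
  have hhC : C * h ≤ ε / 4 := by
    have h1 : h ≤ ε / (4 * (C + 1)) := (min_le_right _ _).trans (min_le_right _ _)
    rw [le_div_iff₀ (by positivity)] at h1
    nlinarith
  have up := hslope h (by rwa [abs_of_pos h0]) h0.ne'
  have dn := hslope (-h) (by rwa [abs_neg, abs_of_pos h0]) (neg_ne_zero.2 h0.ne')
  rw [← sub_eq_add_neg] at dn
  set m : ℕ → ℕ := fun k => ⌊h / dx k⌋₊ with hmdef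
  have hm : Tendsto (fun k => (m k : ℝ) * dx k) atTop (𝓝 h) := tendsto_floor_div_mul hdx hdx0 h0.le
  -- The increment over cell `J` runs from index `J - 1` to `J`, hence a shift by `dx k`, harmless
  -- in the limit.
  have hJ' : Tendsto (fun k => (J k : ℝ) * dx k - dx k) atTop (𝓝 x) := by simpa using hJ.sub hdx0
  have V0 := tendsto_apply_of_lipschitz hV (hW (t, x)) (hN.prodMk_nhds hJ')
  have Vp := tendsto_apply_of_lipschitz hV (hW (t, x + h)) (hN.prodMk_nhds (hJ'.add hm))
  have Vm := tendsto_apply_of_lipschitz hV (hW (t, x - h)) (hN.prodMk_nhds (hJ'.sub hm))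
  have lower := ((Vp.sub V0).div hm h0.ne').sub (hm.const_mul C)
  have upper := ((V0.sub Vm).div hm h0.ne').add (hm.const_mul C)
  have lt1 : D - ε < (W (t, x + h) - W (t, x)) / h - C * h := by
    rw [div_eq_inv_mul]
    linarith [(abs_lt.1 up).1]
  have lt2 : (W (t, x) - W (t, x - h)) / h + C * h < D + ε := by
    have : (W (t, x) - W (t, x - h)) / h = (-h)⁻¹ * (W (t, x - h) - W (t, x)) := by
      field_simp
      ring
    rw [this]
    linarith [(abs_lt.1 dn).2]
  filter_upwards [lower.eventually_const_lt lt1, upper.eventually_lt_const lt2,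
    hN.eventually_const_lt (by linarith : t / 2 < t),
    (hJ'.sub hm).eventually_const_lt (by linarith : x / 4 < x - h),
    hm.eventually_const_lt h0] with k e1 e2 e3 e4 e5
  have hdxk := hdx k
  have hmJ : m k + 1 ≤ J k := by
    have : 0 < ((J k : ℝ) - 1 - m k) * dx k := by linarith
    have := (pos_iff_pos_of_mul_pos this).2 hdxk
    have : ((m k + 1 : ℕ) : ℝ) < J k := by push_cast; linarith
    exact_mod_cast this.le
  obtain ⟨p, hp⟩ := Nat.exists_eq_add_of_le' hmJ
  rw [← add_assoc] at hp
  have hN0 : N k ≠ 0 := fun hc => by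
    rw [hc, Nat.cast_zero, zero_mul] at e3
    linarith
  obtain ⟨n, hn⟩ : ∃ n, N k = n + 1 := Nat.exists_eq_succ_of_ne_zero hN0
  change dist (q k (N k) (J k)) D < ε
  simp only [Pi.div_apply] at e1 e2
  rw [hp] at e1 e2 e4 ⊢
  have hpx : x / 4 < p * dx k := by push_cast at e4; linarith
  have inc : ∀ l, p + 1 ≤ l → q k (N k) (l + 1) ≤ q k (N k) l + C * dx k := by
    intro l hl
    obtain ⟨j, rfl⟩ : ∃ j, l = j + 1 := ⟨l - 1, by omega⟩
    have h1 := hO k n j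
    have hpj : (p : ℝ) ≤ j := by exact_mod_cast (by omega : p ≤ j)
    have h2 : A / ((n + 1) * dt k) ≤ A / (t / 2) := by
      rw [hn] at e3
      push_cast at e3
      gcongr
    have h3 : β / ((j + 1) * dx k) ≤ β / (x / 4) := by
      gcongr
      nlinarith
    have h4 := mul_le_mul_of_nonneg_left (add_le_add h2 h3) hdxk.le
    rw [← hCdef] at h4
    rw [hn]
    change q k (n + 1) (j + 2) ≤ _
    linarith
  have L1 := partial_sum_le (a := q k (N k)) hdxk.le hC (hS k (N k)) (p := p + m k)
    (fun l hl => inc l (by omega)) (m k)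
  have L2 := le_partial_sum (a := q k (N k)) hdxk.le hC (hS k (N k)) inc (m k)
  have a0 : (((p + m k + 1 : ℕ) : ℝ) * dx k - dx k) = ((p + m k : ℕ) : ℝ) * dx k := by
    push_cast; ring
  have a1 : ((p + m k : ℕ) : ℝ) * dx k + m k * dx k = ((p + m k + m k : ℕ) : ℝ) * dx k := by
    push_cast; ring
  have a2 : ((p + m k : ℕ) : ℝ) * dx k - m k * dx k = (p : ℝ) * dx k := by
    push_cast; ring
  rw [a0, a1, hVS, hVS] at e1
  rw [a0, a2, hVS, hVS] at e2
  have f1 : (S k (N k) (p + m k + m k) - S k (N k) (p + m k)) / (m k * dx k)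
      ≤ q k (N k) (p + m k + 1) + C * (m k * dx k) := by
    rw [div_le_iff₀ e5]
    linarith
  have f2 : q k (N k) (p + m k + 1) - C * (m k * dx k)
      ≤ (S k (N k) (p + m k) - S k (N k) p) / (m k * dx k) := by
    rw [le_div_iff₀ e5]
    linarith
  rw [Real.dist_eq, abs_lt]
  constructor <;> linarith

/-- If the space step has a positive limit, the cell averages converge away from the limit grid. -/
theorem exists_tendsto_stepFunction_of_pos {dt dx : ℕ → ℝ} (hdx : ∀ k, 0 < dx k) {ξ τ' : ℝ}
    (hξ : 0 < ξ) (hdxξ : Tendsto dx atTop (𝓝 ξ)) {q S : ℕ → ℕ → ℕ → ℝ}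
    {V : ℕ → ℝ × ℝ → ℝ} {W : ℝ × ℝ → ℝ} {K : ℝ≥0}
    (hV : ∀ k, LipschitzWith K (V k))
    (hVS : ∀ k (n j : ℕ), V k (n * dt k, j * dx k) = S k n j)
    (hS : ∀ k n j, S k n (j + 1) - S k n j = dx k * q k n (j + 1))
    (hW : ∀ z, Tendsto (fun k => V k z) atTop (𝓝 (W z))) {t x : ℝ} (ht : 0 < t) (hx : 0 < x)
    (hN : Tendsto (fun k => (⌊t / dt k⌋₊ : ℝ) * dt k) atTop (𝓝 τ')) (hxξ : ∀ n : ℕ, x ≠ n * ξ) :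
    ∃ l, Tendsto (fun k => stepFunction (dt k) (dx k) (q k) (t, x)) atTop (𝓝 l) := by
  have hfl := eventually_floor_div_eq hξ hdxξ hx.le hxξ
  rcases hj : ⌊x / ξ⌋₊ with _ | i
  · refine ⟨0, tendsto_const_nhds.congr' ?_⟩
    filter_upwards [hfl] with k hk
    rw [hj, Nat.floor_eq_zero, div_lt_one (hdx k)] at hk
    simp [stepFunction, hk.not_ge]
  -- The value in cell `i + 1` is exactly the difference quotient between the nodes `i` and `i + 1`,
  -- which converge.
  · have V0 := tendsto_apply_of_lipschitz hV (hW (τ', i * ξ))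
      (hN.prodMk_nhds (hdxξ.const_mul (i : ℝ)))
    have V1 := tendsto_apply_of_lipschitz hV (hW (τ', ((i + 1 : ℕ) : ℝ) * ξ))
      (hN.prodMk_nhds (hdxξ.const_mul ((i + 1 : ℕ) : ℝ)))
    refine ⟨_, ((V1.sub V0).div hdxξ hξ.ne').congr' ?_⟩
    filter_upwards [hfl] with k hk
    rw [hj] at hk
    have hle : dx k ≤ x := by
      rw [← one_le_div (hdx k), ← Nat.one_le_floor_iff, hk]
      omega
    rw [Pi.div_apply, hVS, hVS, hS, stepFunction, if_pos ⟨ht.le, hle⟩, hk, mul_div_cancel_left₀ _ (hdx k).ne']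

/-! ### Measurability, mesh limits and the final extraction -/

theorem measurable_stepFunction (dt dx : ℝ) (q : ℕ → ℕ → ℝ) :
    Measurable (stepFunction dt dx q) := by
  unfold stepFunction
  refine Measurable.ite ?_ ?_ measurable_const
  · exact (measurableSet_le measurable_const measurable_fst).inter
      (measurableSet_le measurable_const measurable_snd)
  · have h1 : Measurable fun z : ℝ × ℝ => (⌊z.1 / dt⌋₊, ⌊z.2 / dx⌋₊) :=
      (Nat.measurable_floor.comp (measurable_fst.div_const dt)).prodMk
        (Nat.measurable_floor.comp (measurable_snd.div_const dx))
    exact (measurable_of_countable fun p : ℕ × ℕ => q p.1 p.2).comp h1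

theorem abs_stepFunction_le {dt dx M : ℝ} {q : ℕ → ℕ → ℝ} (hM : 0 ≤ M) (hq : ∀ n j, |q n j| ≤ M)
    (z : ℝ × ℝ) : |stepFunction dt dx q z| ≤ M := by
  unfold stepFunction
  split_ifs
  · exact hq _ _
  · simpa using hM

theorem ae_ne_nat_mul (a : ℝ) : ∀ᵐ x : ℝ, ∀ n : ℕ, x ≠ n * a :=
  ae_all_iff.2 fun n => by simp [ae_iff]

/-- The bound `dt ≤ C * dx` keeps time steps bounded with the space steps, and excludes `ξ = 0` with
`τ > 0`. -/
theorem exists_subseq_steps {dt dx : ℕ → ℝ} (hdt : ∀ k, 0 < dt k) (hdx : ∀ k, 0 < dx k) {C : ℝ}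
    (hC : ∀ k, dt k ≤ C * dx k) :
    ∃ φ : ℕ → ℕ, StrictMono φ ∧ (Tendsto (dx ∘ φ) atTop atTop ∨
      ∃ τ ξ : ℝ, 0 ≤ τ ∧ τ ≤ C * ξ ∧ 0 ≤ ξ ∧ Tendsto (dt ∘ φ) atTop (𝓝 τ) ∧
        Tendsto (dx ∘ φ) atTop (𝓝 ξ)) := by
  by_cases hb : ∃ R, ∃ᶠ k in atTop, dx k ≤ R
  · obtain ⟨R, hR⟩ := hb
    have hcpt : IsCompact (Icc 0 (|C| * R) ×ˢ Icc 0 R) := isCompact_Icc.prod isCompact_Icc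
    obtain ⟨⟨τ, ξ⟩, -, φ, hφ, hlim⟩ := hcpt.tendsto_subseq' (x := fun k => (dt k, dx k))
      (hR.mono fun k hk => ⟨⟨(hdt k).le, (hC k).trans ((mul_le_mul_of_nonneg_right (le_abs_self C)
        (hdx k).le).trans (mul_le_mul_of_nonneg_left hk (abs_nonneg C)))⟩, (hdx k).le, hk⟩)
    have h1 : Tendsto (dt ∘ φ) atTop (𝓝 τ) := (continuous_fst.tendsto _).comp hlim
    have h2 : Tendsto (dx ∘ φ) atTop (𝓝 ξ) := (continuous_snd.tendsto _).comp hlim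
    refine ⟨φ, hφ, Or.inr ⟨τ, ξ, ?_, ?_, ?_, h1, h2⟩⟩
    · exact ge_of_tendsto' h1 fun k => (hdt _).le
    · exact le_of_tendsto_of_tendsto' h1 (h2.const_mul C) fun k => hC _
    · exact ge_of_tendsto' h2 fun k => (hdx _).le
  · push Not at hb
    refine ⟨id, strictMono_id, Or.inl (tendsto_atTop.2 fun R => ?_)⟩
    exact (hb R).mono fun k hk => hk.le

/-- Almost everywhere convergence along sequences of grids whose potentials converge. -/
theorem ae_exists_tendsto_stepFunction {dt dx : ℕ → ℝ} (hdt : ∀ k, 0 < dt k) (hdx : ∀ k, 0 < dx k)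
    {q S : ℕ → ℕ → ℕ → ℝ} {V : ℕ → ℝ × ℝ → ℝ} {W : ℝ × ℝ → ℝ} {K : ℝ≥0} {A β C : ℝ}
    (hA : 0 ≤ A) (hβ : 0 ≤ β) (hV : ∀ k, LipschitzWith K (V k)) (hWlip : LipschitzWith K W)
    (hVS : ∀ k (n j : ℕ), V k (n * dt k, j * dx k) = S k n j)
    (hS : ∀ k n j, S k n (j + 1) - S k n j = dx k * q k n (j + 1))
    (hO : ∀ k (n j : ℕ), q k (n + 1) (j + 2) - q k (n + 1) (j + 1) ≤
      dx k * (A / ((n + 1) * dt k) + β / ((j + 1) * dx k)))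
    (hW : ∀ z, Tendsto (fun k => V k z) atTop (𝓝 (W z)))
    (hsteps : Tendsto dx atTop atTop ∨ ∃ τ ξ : ℝ, 0 ≤ τ ∧ τ ≤ C * ξ ∧ 0 ≤ ξ ∧
      Tendsto dt atTop (𝓝 τ) ∧ Tendsto dx atTop (𝓝 ξ)) :
    ∀ᵐ z ∂(volume.restrict (Ioi (0 : ℝ) ×ˢ Ioi (0 : ℝ))),
      ∃ l, Tendsto (fun k => stepFunction (dt k) (dx k) (q k) z) atTop (𝓝 l) := by
  rw [ae_restrict_iff' (measurableSet_Ioi.prod measurableSet_Ioi), Measure.volume_eq_prod]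
  -- Measurability of the convergence set lets Fubini reduce the claim to almost every `x` for
  -- almost every `t`.
  have hmeas : MeasurableSet {z : ℝ × ℝ | z ∈ Ioi (0 : ℝ) ×ˢ Ioi (0 : ℝ) →
      ∃ l, Tendsto (fun k => stepFunction (dt k) (dx k) (q k) z) atTop (𝓝 l)} := by
    have h1 := measurableSet_exists_tendsto (l := atTop)
      (f := fun k => stepFunction (dt k) (dx k) (q k)) fun k => measurable_stepFunction _ _ _
    have h2 : MeasurableSet (Ioi (0 : ℝ) ×ˢ Ioi (0 : ℝ)) := measurableSet_Ioi.prod measurableSet_Ioi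
    exact (h2.compl.union h1).congr (by ext z; simp [imp_iff_not_or])
  refine (Measure.ae_prod_iff_ae_ae hmeas).2 ?_
  rcases hsteps with hinf | ⟨τ, ξ, hτ0, hτξ, hξ0, hτ, hξ⟩
  · refine Eventually.of_forall fun t => Eventually.of_forall fun x _ => ⟨0, ?_⟩
    refine tendsto_const_nhds.congr' ?_
    filter_upwards [hinf.eventually_gt_atTop x] with k hk
    simp [stepFunction, hk.not_ge]
  rcases hξ0.eq_or_lt with rfl | hξpos
  · obtain rfl : τ = 0 := le_antisymm (by simpa using hτξ) hτ0
    refine Eventually.of_forall fun t => ?_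
    have hlip : LipschitzWith K fun y => W (t, y) := by
      simpa [Function.comp_def] using hWlip.comp (LipschitzWith.prodMk_left t)
    filter_upwards [hlip.ae_differentiableAt] with x hdiff hpos
    refine ⟨_, (tendsto_cell_of_hasDerivAt hdt hdx hτ hξ hA hβ hV hVS hS hO hW hpos.1 hpos.2
      hdiff.hasDerivAt).congr' ?_⟩
    filter_upwards [hξ.eventually_lt_const hpos.2] with k hk
    rw [stepFunction, if_pos ⟨le_of_lt hpos.1, hk.le⟩]
  · have htime : ∀ t : ℝ, 0 < t → (∀ n : ℕ, t ≠ n * τ) →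
        ∃ τ', Tendsto (fun k => (⌊t / dt k⌋₊ : ℝ) * dt k) atTop (𝓝 τ') := by
      intro t ht hne
      rcases hτ0.eq_or_lt with rfl | hτpos
      · exact ⟨t, tendsto_floor_div_mul hdt hτ ht.le⟩
      · refine ⟨_, (hτ.const_mul (⌊t / τ⌋₊ : ℝ)).congr' ?_⟩
        filter_upwards [eventually_floor_div_eq hτpos hτ ht.le hne] with k hk
        rw [hk]
    filter_upwards [ae_ne_nat_mul τ] with t ht
    filter_upwards [ae_ne_nat_mul ξ] with x hx hpos
    obtain ⟨τ', hτ'⟩ := htime t hpos.1 ht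
    exact exists_tendsto_stepFunction_of_pos hdx hξpos hξ hV hVS hS hW hpos.1 hpos.2 hτ' hx

theorem proposition6p2
    (f : ℝ → ℝ) (δ M : ℝ) (L : ℝ≥0)
    (hf : ContDiff ℝ 2 f) (hδ : 0 < δ) (hM : 0 < M)
    (hconv : ∀ x ∈ Icc (-M) M, δ ≤ deriv (deriv f) x)
    (hL : LipschitzOnWith L f (Icc (-M) M))
    (Δt Δx : ℕ → ℝ) (hΔt : ∀ k, 0 < Δt k) (hΔx : ∀ k, 0 < Δx k)
    (hCFL₁ : ∀ k, 2 * (L : ℝ) ≤ Δx k / Δt k)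
    (hCFL₂ : ∀ k, Δt k / Δx k * (δ / 2) * M ≤ 1)
    (q : ℕ → ℕ → ℕ → ℝ)
    (hq : ∀ k, IsGodunovSolution f (Δt k) (Δx k) (q k))
    (hbound : ∀ k n j, |q k n j| ≤ M) :
    ∃ (φ : ℕ → ℕ) (ρ : ℝ × ℝ → ℝ),
      StrictMono φ ∧
      MemLp ρ ∞ (volume.restrict (Ioi (0 : ℝ) ×ˢ Ioi (0 : ℝ))) ∧
      ∀ᵐ z ∂(volume.restrict (Ioi (0 : ℝ) ×ˢ Ioi (0 : ℝ))),
        Tendsto (fun k => stepFunction (Δt (φ k)) (Δx (φ k)) (q (φ k)) z) atTop (𝓝 (ρ z)) := by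
  obtain ⟨θ, hθ⟩ := exists_convexData hf hδ hM hconv hL
  have hmem : ∀ k n j, q k n j ∈ Icc (-M) M := fun k n j => abs_le.1 (hbound k n j)
  have hlip : ∀ x ∈ Icc (-M) M, ∀ y ∈ Icc (-M) M, |f x - f y| ≤ (L : ℝ) * |x - y| :=
    fun x hx y hy => hL.dist_le_mul x hx y hy
  set β := 64 * (L : ℝ) / δ + 2 * M with hβ
  have hβ0 : 0 ≤ β := by positivity
  have hO : ∀ k (n j : ℕ), q k (n + 1) (j + 2) - q k (n + 1) (j + 1) ≤
      Δx k * (32 / δ / ((n + 1) * Δt k) + β / ((j + 1) * Δx k)) := by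
    intro k n j
    have ht := hΔt k
    have hx := hΔx k
    have h1 := hCFL₁ k
    rw [le_div_iff₀ ht] at h1
    refine (hθ.oleinik hlip ht hx hM ?_ ?_ (hq k) (hmem k) n j).trans (le_of_eq ?_)
    · rw [div_mul_eq_mul_div, div_le_iff₀ hx]
      linarith
    · linarith [hCFL₂ k]
    · rw [← hβ]
      field_simp
  obtain ⟨F, hF⟩ : ∃ F : ℝ≥0, ∀ p ∈ Icc (-M) M, ∀ r ∈ Icc (-M) M, |godunovFlux f p r| ≤ F := by
    obtain ⟨B, hB⟩ := (isCompact_Icc (a := -M) (b := M)).exists_bound_of_continuousOn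
      hf.continuous.continuousOn
    refine ⟨B.toNNReal, fun p hp r hr => ?_⟩
    rw [hθ.godunovFlux_eq hp hr]
    have h1 := hB _ ⟨hp.1.trans (le_max_left p θ), max_le hp.2 hθ.mem.2⟩
    have h2 := hB _ ⟨le_min hr.1 hθ.mem.1, (min_le_left r θ).trans hr.2⟩
    exact (abs_max_le_max_abs_abs.trans (max_le h1 h2)).trans (Real.le_coe_toNNReal B)
  choose S hS0 hSx hSt using fun k => exists_potential (hΔx k) (hq k)
  have hext : ∀ k, ∃ V : ℝ × ℝ → ℝ, LipschitzWith (F + M.toNNReal) V ∧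
      ∀ n j : ℕ, V (n * Δt k, j * Δx k) = S k n j := fun k => by
    refine exists_lipschitz_extension_of_lattice (hΔt k) (hΔx k) (fun n j => ?_) fun n j => ?_
    · rw [hSt, abs_neg, abs_mul, abs_of_pos (hΔt k), mul_comm]
      exact mul_le_mul_of_nonneg_right (hF _ (hmem _ _ _) _ (hmem _ _ _)) (hΔt k).le
    · rw [hSx, abs_mul, abs_of_pos (hΔx k), mul_comm, Real.coe_toNNReal M hM.le]
      exact mul_le_mul_of_nonneg_right (hbound _ _ _) (hΔx k).le
  choose V hV hVS using hext
  -- The second mesh condition reads `Δt ≤ 2 / (δ * M) * Δx`.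
  obtain ⟨φ₁, hφ₁, hsteps⟩ := exists_subseq_steps hΔt hΔx (C := 2 / (δ * M)) fun k => by
    have h := hCFL₂ k
    rw [mul_assoc, div_mul_eq_mul_div, div_le_one (hΔx k)] at h
    rw [div_mul_eq_mul_div, le_div_iff₀ (by positivity)]
    linarith
  obtain ⟨φ₂, hφ₂, W, hWlip, hW⟩ := exists_subseq_tendsto_of_lipschitz ((0 : ℝ), (0 : ℝ))
    (fun k => hV (φ₁ k)) fun k => by simpa [hS0] using hVS (φ₁ k) 0 0
  set φ := φ₁ ∘ φ₂ with hφ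
  have hae := ae_exists_tendsto_stepFunction (dt := Δt ∘ φ) (dx := Δx ∘ φ) (q := q ∘ φ)
    (S := S ∘ φ) (V := V ∘ φ) (C := 2 / (δ * M)) (fun k => hΔt _) (fun k => hΔx _)
    (by positivity) hβ0 (fun k => hV _) hWlip (fun k => hVS _) (fun k => hSx _) (fun k => hO _) hW
    (hsteps.imp (fun h => h.comp hφ₂.tendsto_atTop) fun ⟨τ, ξ, h1, h2, h3, h4, h5⟩ =>
      ⟨τ, ξ, h1, h2, h3, h4.comp hφ₂.tendsto_atTop, h5.comp hφ₂.tendsto_atTop⟩)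
  obtain ⟨ρ, hρm, hρ⟩ := measurable_limit_of_tendsto_metrizable_ae
    (fun k => (measurable_stepFunction _ _ _).aemeasurable) hae
  refine ⟨φ, ρ, hφ₁.comp hφ₂, memLp_top_of_bound hρm.aestronglyMeasurable M ?_, hρ⟩
  filter_upwards [hρ] with z hz
  exact le_of_tendsto hz.norm
    (Eventually.of_forall fun k => abs_stepFunction_le hM.le (hbound (φ k)) z)
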